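/- A time scale is a nonempty closed set $\mathbb{T}\subseteq\mathbb{R}$. Let $\sigma(t)=\inf\{s\in\mathbb{T}:s>t\}$ and $\rho(t)=\sup\{s\in\mathbb{T}:s<t\}$ for $t\in\mathbb T$ (with $\inf\emptyset=\sup\mathbb{T}$, $\sup\emptyset=\inf\mathbb{T}$), and let $\mathbb{T}^\kappa=\mathbb{T}\setminus(\rho(\sup\mathbb{T}),\sup\mathbb{T}]$ if $\sup\mathbb{T}<\infty$ and $\mathbb{T}^\kappa=\mathbb{T}$ otherwise. A function $f:\mathbb{T}\to\mathbb{R}$ has delta derivative $f^\Delta(t)=d$ at $t\in\mathbb{T}^\kappa$ if for every $\varepsilon>0$ there is $\delta>0$ with $|f(\sigma(t))-f(s)-d(\sigma(t)-s)|\le\varepsilon|\sigma(t)-s|$ for all $s\in(t-\delta,t+\delta)\cap\mathbb{T}$. The delta integral is $\int_a^b f(s)\,\Delta s=F(b)-F(a)$ for $a,b\in\mathbb{T}$, where $F:\mathbb{T}\to\mathbb{R}$ is a pre-antiderivative of $f$: $F$ is continuous and $F^\Delta=f$ on some $D\subseteq\mathbb{T}^\kappa$ such that $\mathbb{T}^\kappa\setminus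 D$ is countable and contains no $t$ with $\sigma(t)>t$ (for continuous $f$ such an $F$ exists and is unique up to a constant). For continuous $p:\mathbb T\to[0,\infty)$ and $t_0=\min\mathbb T$, $e_p(\cdot,t_0)$ denotes the unique solution on $\mathbb{T}$ of $x^\Delta(t)=p(t)x(t)$ for $t\in\mathbb T^\kappa$, $x(t_0)=1$. **Theorem.** Let $\mathbb{T}_1,\mathbb{T}_2$ be time scales, each containing $0$ and some positive number, and put $S_i=[0,\infty)\cap\mathbb{T}_i$. All integrals over the $i$-th variable (denoted $\Delta_i$) and the exponential function below are those of the time scales $S_i$. Let $c_1,c_2\ge 0$ be constants and let $u,v,h_1,h_2,h_3,h_4:S_1\times S_2\to[0,\infty)$ be continuous. Suppose that for all $(t_1,t_2)\in S_1\times S_2$ $$u(t_1,t_2)\le c_1+\int_0^{t_1}\!\int_0^{t_2}h_1(s_1,s_2)u(s_1,s_2)\,\Delta_2s_2\,\Delta_1s_1+\int_0^{t_1}\!\int_0^{t_2}h_2(s_1,s_2)v(s_1,s_2)\,\Delta_2s_2\,\Delta_1s_1,$$ $$v(t_1,t_2)\le c_2+\int_0^{t_1}\!\int_0^{t_2}h_3(s_1,s_2)u(s_1,s_2)\,\Delta_2s_2\,\Delta_1s_1+\int_0^{t_1}\!\int_0^{t_2}h_4(s_1,s_2)v(s_1,s_2)\,\Delta_2s_2\,\Delta_1s_1.$$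 Put $c_3=c_1+c_2$ and, for $(t_1,t_2)\in S_1\times S_2$, $$H(t_1,t_2)=\max\{h_1(t_1,t_2)+h_3(t_1,t_2),\,h_2(t_1,t_2)+h_4(t_1,t_2)\},$$ $$A(t_1,t_2)=c_3\int_0^{t_1}\!\int_0^{t_2}H(s_1,s_2)\,\Delta_2s_2\,\Delta_1s_1,\qquad c(t_1,t_2)=\int_0^{t_2}H(t_1,s_2)\,\Delta_2s_2.$$ Then for all $(t_1,t_2)\in S_1\times S_2$ $$u(t_1,t_2)+v(t_1,t_2)\le c_3+A(t_1,t_2)\,e_{c(\cdot,t_2)}(t_1,0).$$ -/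

import Mathlib

/-! Time scale calculus.  A function on a time scale `T : Set ℝ` is represented by a function
`ℝ → ℝ`; none of the notions below looks at its values outside `T`, except that the functions
obtained by choice are only meaningful on `T`. -/

/-- A time scale is a nonempty closed subset of the real numbers. -/
structure IsTimeScale (T : Set ℝ) : Prop where
  nonempty : T.Nonempty
  isClosed : IsClosed T

/-- The set `ℝ₊ ∩ T`, with `ℝ₊ = [0, ∞)`.  It is itself a time scale if `T` is one and `0 ∈ T`. -/
def nonnegPart (T : Set ℝ) : Set ℝ := Set.Ici 0 ∩ T

open Classical in
/-- The forward jump operator `σ(t) = inf {s ∈ T : s > t}`, with `inf ∅ = sup T`. -/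
noncomputable def forwardJump (T : Set ℝ) (t : ℝ) : ℝ :=
  if {s ∈ T | t < s}.Nonempty then sInf {s ∈ T | t < s} else sSup T

open Classical in
/-- The backward jump operator `ρ(t) = sup {s ∈ T : s < t}`, with `sup ∅ = inf T`. -/
noncomputable def backwardJump (T : Set ℝ) (t : ℝ) : ℝ :=
  if {s ∈ T | s < t}.Nonempty then sSup {s ∈ T | s < t} else sInf T

open Classical in
/-- The set `T^κ`: `T` without `(ρ(sup T), sup T]` if `T` is bounded above, and `T` otherwise. -/
noncomputable def kappaSet (T : Set ℝ) : Set ℝ :=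
  if BddAbove T then T \ Set.Ioc (backwardJump T (sSup T)) (sSup T) else T

/-- `f` is delta (Hilger) differentiable at `t` on the time scale `T`, with `f^Δ(t) = d`. -/
def HasDeltaDeriv (T : Set ℝ) (f : ℝ → ℝ) (d t : ℝ) : Prop :=
  ∀ ε > 0, ∃ δ > 0, ∀ s ∈ Set.Ioo (t - δ) (t + δ) ∩ T, s ≠ forwardJump T t →
    |f (forwardJump T t) - f s - d * (forwardJump T t - s)| ≤ ε * |forwardJump T t - s|

/-- `F` is a pre-antiderivative of `f` on `T`: it is continuous on `T` and, for some region of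
differentiation `D ⊆ T^κ` such that `T^κ \ D` is countable and contains no right-scattered point,
`F^Δ(t) = f(t)` for all `t ∈ D`. -/
def IsPreAntiderivative (T : Set ℝ) (f F : ℝ → ℝ) : Prop :=
  ContinuousOn F T ∧
    ∃ D ⊆ kappaSet T, (kappaSet T \ D).Countable ∧
      (∀ t ∈ kappaSet T \ D, ¬ t < forwardJump T t) ∧
      ∀ t ∈ D, HasDeltaDeriv T F (f t) t

open Classical in
/-- The Cauchy delta integral `∫_a^b f(s) Δs = F(b) - F(a)`, for `a, b ∈ T`, where `F` is a
pre-antiderivative of `f` on `T` (every regulated function, in particular every continuous one, has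
a pre-antiderivative, and it is unique up to a constant).  The value is `0` if there is none. -/
noncomputable def deltaIntegral (T : Set ℝ) (f : ℝ → ℝ) (a b : ℝ) : ℝ :=
  if h : ∃ F : ℝ → ℝ, IsPreAntiderivative T f F then h.choose b - h.choose a else 0

/-- `x` solves the initial value problem `x^Δ = p(t) x`, `x(t₀) = 1` on `T`. -/
def IsDeltaExpSolution (T : Set ℝ) (p : ℝ → ℝ) (t₀ : ℝ) (x : ℝ → ℝ) : Prop :=
  x t₀ = 1 ∧ ∀ t ∈ kappaSet T, HasDeltaDeriv T x (p t * x t) t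

open Classical in
/-- The exponential function `e_p(t, t₀)` on `T`: for rd-continuous and regressive `p` and
`t₀ ∈ T`, the unique solution on `T` of `x^Δ = p(t) x`, `x(t₀) = 1`.  The value is `0` if there is
no solution. -/
noncomputable def deltaExp (T : Set ℝ) (p : ℝ → ℝ) (t t₀ : ℝ) : ℝ :=
  if h : ∃ x : ℝ → ℝ, IsDeltaExpSolution T p t₀ x then h.choose t else 0

/-- The iterated delta integral `∫_0^{t₁} ∫_0^{t₂} f(s₁, s₂) Δ₂s₂ Δ₁s₁` on the time scales
`S₁, S₂`. -/
noncomputable def deltaIntegral₂ (S₁ S₂ : Set ℝ) (f : ℝ → ℝ → ℝ) (t₁ t₂ : ℝ) : ℝ :=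
  deltaIntegral S₁ (fun s₁ => deltaIntegral S₂ (fun s₂ => f s₁ s₂) 0 t₂) 0 t₁

/-!
Integrals and exponential functions on a time scale `T` with least element `a` are reduced to
Lebesgue integrals on the real line. If `f` is continuous on `T`, then `f ∘ ρ` is locally integrable
on `ℝ`, it is constantly `f t` on each gap `(t, σ(t)]`, and `t ↦ ∫_a^t f(ρ(r)) dr` has delta
derivative `f` at all points of `T` (`TimeScale.hasDeltaDeriv_primitive`). A continuous function
whose delta derivative vanishes off a countable set of right-dense points is constant
(`TimeScale.eq_of_hasDeltaDeriv_zero`), so the delta integral, defined through an arbitrary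
pre-antiderivative, is this Lebesgue integral (`TimeScale.deltaIntegral_eq`). In the same way
`e_p(·, a)` exists, by a Volterra series, and satisfies
`e_p(t) = 1 + ∫_a^t p(ρ(r)) e_p(ρ(r)) dr` (`TimeScale.deltaExp_spec`).

The inequality itself follows by adding the two hypotheses: `w = u + v` satisfies `w ≤ c₃ + ∬ H w`.
For fixed `t₂`, the right-hand side `y` is nondecreasing in the second variable, hence
`y ≤ c₃ + ∫ c y`, and Grönwall's inequality (`TimeScale.nonpos_of_le_integral`) applied to the
difference `y - c₃ e_c` gives `y ≤ c₃ e_c`. Since `e_c` is nondecreasing,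
`e_c(t) = 1 + ∫ c e_c ≤ 1 + e_c(t) ∫ c`, and `c₃ ∫ c` is `A`.
-/

namespace TimeScale

open MeasureTheory Set Filter Topology intervalIntegral

/-! ### Jump operators -/

section Jump

variable {T : Set ℝ} {a s t r : ℝ}

lemma backwardJump_mem (hT : IsClosed T) (ha : IsLeast T a) (r : ℝ) : backwardJump T r ∈ T := by
  unfold backwardJump
  split_ifs with h
  · have h1 : sSup {s ∈ T | s < r} ∈ closure {s ∈ T | s < r} :=
      csSup_mem_closure h ⟨r, fun s hs => hs.2.le⟩
    exact hT.closure_subset (closure_mono (fun s hs => hs.1) h1)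
  · rw [ha.csInf_eq]; exact ha.1

lemma le_backwardJump (hs : s ∈ T) (hsr : s < r) : s ≤ backwardJump T r := by
  have hne : {s ∈ T | s < r}.Nonempty := ⟨s, hs, hsr⟩
  unfold backwardJump
  rw [if_pos hne]
  exact le_csSup ⟨r, fun s hs => hs.2.le⟩ ⟨hs, hsr⟩

lemma backwardJump_le_of_forall (ha : IsLeast T a) (hat : a ≤ t)
    (h : ∀ s ∈ T, s < r → s ≤ t) : backwardJump T r ≤ t := by
  unfold backwardJump
  split_ifs with hne
  · exact csSup_le hne fun s hs => h s hs.1 hs.2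
  · rwa [ha.csInf_eq]

lemma backwardJump_le (ha : IsLeast T a) (har : a ≤ r) : backwardJump T r ≤ r :=
  backwardJump_le_of_forall ha har fun _ _ h => h.le

lemma monotone_backwardJump (hT : IsClosed T) (ha : IsLeast T a) : Monotone (backwardJump T) :=
  fun _ _ hxy => backwardJump_le_of_forall ha (ha.2 (backwardJump_mem hT ha _))
    fun _ hs hsx => le_backwardJump hs (hsx.trans_le hxy)

lemma forwardJump_le (hs : s ∈ T) (hts : t < s) : forwardJump T t ≤ s := by
  have hne : {s ∈ T | t < s}.Nonempty := ⟨s, hs, hts⟩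
  unfold forwardJump
  rw [if_pos hne]
  exact csInf_le ⟨t, fun s hs => hs.2.le⟩ ⟨hs, hts⟩

lemma forwardJump_mem_and_le (hT : IsClosed T) (ht : t ∈ T) :
    forwardJump T t ∈ T ∧ t ≤ forwardJump T t := by
  unfold forwardJump
  split_ifs with h
  · refine ⟨?_, le_csInf h fun s hs => hs.2.le⟩
    exact hT.closure_subset (closure_mono (fun s hs => hs.1)
      (csInf_mem_closure h ⟨t, fun s hs => hs.2.le⟩))
  · have hgr : IsGreatest T t :=
      ⟨ht, fun s hs => not_lt.1 fun hts => h ⟨s, hs, hts⟩⟩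
    rw [hgr.csSup_eq]
    exact ⟨ht, le_rfl⟩

lemma forwardJump_mem (hT : IsClosed T) (ht : t ∈ T) : forwardJump T t ∈ T :=
  (forwardJump_mem_and_le hT ht).1

lemma le_forwardJump (hT : IsClosed T) (ht : t ∈ T) : t ≤ forwardJump T t :=
  (forwardJump_mem_and_le hT ht).2

lemma backwardJump_eq (ha : IsLeast T a) (ht : t ∈ T) (htr : t < r)
    (hr : r ≤ forwardJump T t) : backwardJump T r = t :=
  le_antisymm (backwardJump_le_of_forall ha (ha.2 ht) fun _ hs hsr =>
      not_lt.1 fun hts => absurd (forwardJump_le hs hts) (hsr.trans_le hr).not_ge)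
    (le_backwardJump ht htr)

/-- At a left-scattered point, the forward jump undoes the backward jump. -/
lemma forwardJump_backwardJump (hr : r ∈ T)
    (h : backwardJump T r < r) : forwardJump T (backwardJump T r) = r := by
  refine le_antisymm (forwardJump_le hr h) (not_lt.1 fun h' => ?_)
  have hne : {s ∈ T | backwardJump T r < s}.Nonempty := ⟨r, hr, h⟩
  rw [forwardJump, if_pos hne] at h'
  obtain ⟨s, hs, hsr⟩ := exists_lt_of_csInf_lt hne h'
  exact (le_backwardJump hs.1 hsr).not_gt hs.2

lemma kappaSet_subset (T : Set ℝ) : kappaSet T ⊆ T := by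
  unfold kappaSet
  split_ifs
  · exact sdiff_subset
  · exact subset_rfl

lemma mem_kappaSet_of_lt {b : ℝ} (ht : t ∈ T) (hb : b ∈ T) (htb : t < b) : t ∈ kappaSet T := by
  unfold kappaSet
  split_ifs with h
  · exact ⟨ht, fun h' => h'.1.not_ge (le_backwardJump ht (htb.trans_le (le_csSup h hb)))⟩
  · exact ht

lemma countable_rightScattered (T : Set ℝ) : {t ∈ T | t < forwardJump T t}.Countable := by
  refine (countable_setOfPred_isolated_right_within (s := T)).mono ?_
  rintro t ⟨ht, hlt⟩
  refine ⟨ht, ?_⟩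
  rw [← Filter.empty_mem_iff_bot, mem_nhdsWithin]
  refine ⟨Iio (forwardJump T t), isOpen_Iio, hlt, ?_⟩
  rintro s ⟨hs, hsT, hts⟩
  exact absurd (forwardJump_le hsT hts) (not_le.2 hs)

end Jump

/-! ### The delta integral as a Lebesgue integral -/

section Primitive

variable {T : Set ℝ} {a : ℝ} {f : ℝ → ℝ}

lemma measurable_comp_backwardJump (hT : IsClosed T) (ha : IsLeast T a) (hf : ContinuousOn f T) :
    Measurable fun r => f (backwardJump T r) :=
  (continuousOn_iff_continuous_domRestrict.1 hf).measurable.comp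
    ((monotone_backwardJump hT ha).measurable.subtype_mk (h := backwardJump_mem hT ha))

lemma exists_bound (hT : IsClosed T) (hf : ContinuousOn f T) (a b : ℝ) :
    ∃ C, 0 ≤ C ∧ ∀ t ∈ T, t ∈ Icc a b → |f t| ≤ C := by
  obtain ⟨C, hC⟩ := (isCompact_Icc.inter_left hT).exists_bound_of_continuousOn
    (f := f) (hf.mono (inter_subset_left (t := Icc a b)))
  exact ⟨max C 0, le_max_right _ _, fun t ht htb => (hC t ⟨ht, htb⟩).trans (le_max_left _ _)⟩

lemma intervalIntegrable_comp_backwardJump (hT : IsClosed T) (ha : IsLeast T a)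
    (hf : ContinuousOn f T) (x y : ℝ) :
    IntervalIntegrable (fun r => f (backwardJump T r)) volume x y := by
  obtain ⟨C, -, hC⟩ := exists_bound hT hf a (max a (max x y))
  refine (intervalIntegrable_const (c := C)).mono_fun
    (measurable_comp_backwardJump hT ha hf).aestronglyMeasurable ?_
  refine (ae_restrict_iff' measurableSet_uIoc).2 (Eventually.of_forall fun r hr => ?_)
  refine (hC _ (backwardJump_mem hT ha r) ⟨ha.2 (backwardJump_mem hT ha r), ?_⟩).trans
    (le_abs_self C)
  exact (monotone_backwardJump hT ha (hr.2.trans (le_max_right a _))).trans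
    (backwardJump_le ha (le_max_left _ _))

lemma continuous_primitive_comp_backwardJump (hT : IsClosed T) (ha : IsLeast T a)
    (hf : ContinuousOn f T) : Continuous fun t => ∫ r in a..t, f (backwardJump T r) :=
  continuous_primitive (intervalIntegrable_comp_backwardJump hT ha hf) a

/-- The integrand `f ∘ ρ` is constantly `f t` on a right gap `(t, σ(t)]`, and for `s ∈ T` close to
`t` it only takes values of `f` between `s` and `t` on the rest of the interval from `s` to
`σ(t)`. -/
theorem hasDeltaDeriv_primitive (hT : IsClosed T) (ha : IsLeast T a) (hf : ContinuousOn f T)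
    {t : ℝ} (ht : t ∈ T) :
    HasDeltaDeriv T (fun t => ∫ r in a..t, f (backwardJump T r)) (f t) t := by
  intro ε hε
  obtain ⟨δ, hδ, h⟩ := Metric.continuousWithinAt_iff.1 (hf t ht) ε hε
  refine ⟨δ, hδ, fun s hs _ => ?_⟩
  have hint := intervalIntegrable_comp_backwardJump hT ha hf
  have hσ := le_forwardJump hT ht
  have e : (∫ r in a..forwardJump T t, f (backwardJump T r)) - (∫ r in a..s, f (backwardJump T r))
      - f t * (forwardJump T t - s)
      = ∫ r in s..forwardJump T t, (f (backwardJump T r) - f t) := by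
    rw [integral_sub (hint _ _) intervalIntegrable_const, integral_interval_sub_left (hint _ _)
      (hint _ _), intervalIntegral.integral_const, smul_eq_mul, mul_comm]
  rw [e]
  rw [← Real.norm_eq_abs (∫ _ in _.._, _)]
  refine intervalIntegral.norm_integral_le_of_norm_le_const fun r hr => ?_
  have hm := backwardJump_mem hT ha r
  have hat := ha.2 ht
  have has := ha.2 hs.2
  refine (h hm ?_).le
  rw [Real.dist_eq, abs_lt]
  rcases mem_uIoc.1 hr with ⟨h1, h2⟩ | ⟨h1, h2⟩
  · have h3 := le_backwardJump hs.2 h1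
    have h4 : backwardJump T r ≤ t := by
      rcases le_or_gt r t with h5 | h5
      · exact (backwardJump_le ha (has.trans h1.le)).trans h5
      · exact (backwardJump_eq ha ht h5 h2).le
    constructor <;> linarith [hs.1.1]
  · have h3 := le_backwardJump ht (hσ.trans_lt h1)
    have h4 := backwardJump_le ha ((hat.trans hσ).trans h1.le)
    constructor <;> linarith [hs.1.2]

lemma isPreAntiderivative_primitive (hT : IsClosed T) (ha : IsLeast T a)
    (hf : ContinuousOn f T) :
    IsPreAntiderivative T f fun t => ∫ r in a..t, f (backwardJump T r) := by
  exact ⟨(continuous_primitive_comp_backwardJump hT ha hf).continuousOn, kappaSet T, subset_rfl,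
    by simp, by simp, fun t ht => hasDeltaDeriv_primitive hT ha hf (kappaSet_subset T ht)⟩

lemma _root_.HasDeltaDeriv.sub {F G : ℝ → ℝ} {d e t : ℝ} (hF : HasDeltaDeriv T F d t)
    (hG : HasDeltaDeriv T G e t) : HasDeltaDeriv T (fun s => F s - G s) (d - e) t := by
  intro ε hε
  obtain ⟨δ, hδ, h⟩ := hF (ε / 2) (half_pos hε)
  obtain ⟨δ', hδ', h'⟩ := hG (ε / 2) (half_pos hε)
  refine ⟨min δ δ', lt_min hδ hδ', fun s hs hne => ?_⟩
  have h1 := h s ⟨⟨by linarith [hs.1.1, min_le_left δ δ'], by linarith [hs.1.2, min_le_left δ δ']⟩,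
    hs.2⟩ hne
  have h2 := h' s ⟨⟨by linarith [hs.1.1, min_le_right δ δ'],
    by linarith [hs.1.2, min_le_right δ δ']⟩, hs.2⟩ hne
  calc _ = |(F (forwardJump T t) - F s - d * (forwardJump T t - s))
        - (G (forwardJump T t) - G s - e * (forwardJump T t - s))| := by congr 1; ring
    _ ≤ _ := abs_sub _ _
    _ ≤ _ := by linarith

/-- The value of a delta differentiable function at `σ(t)` is determined by its value at `t`. -/
lemma _root_.HasDeltaDeriv.apply_forwardJump {F : ℝ → ℝ} {d t : ℝ} (ht : t ∈ T)
    (hF : HasDeltaDeriv T F d t) :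
    F (forwardJump T t) = F t + d * (forwardJump T t - t) := by
  by_cases hne : t = forwardJump T t
  · simp [← hne]
  have h : ∀ ε > 0, |F (forwardJump T t) - F t - d * (forwardJump T t - t)| ≤
      ε * |forwardJump T t - t| := by
    intro ε hε
    obtain ⟨δ, hδ, h⟩ := hF ε hε
    exact h t ⟨⟨by linarith, by linarith⟩, ht⟩ hne
  have hpos : 0 < |forwardJump T t - t| := abs_pos.2 (sub_ne_zero.2 (Ne.symm hne))
  have h0 : |F (forwardJump T t) - F t - d * (forwardJump T t - t)| ≤ 0 := by
    refine le_of_forall_pos_le_add fun η hη => ?_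
    have := h _ (div_pos hη hpos)
    rwa [div_mul_cancel₀ _ hpos.ne', ← zero_add η] at this
  linarith [abs_nonpos_iff.1 h0]

/-- A continuous function on `T` whose delta derivative vanishes off a countable set of right-dense
points is constant: it does not change across gaps, so `K ∘ ρ` is a continuous extension of `K` to
the real line, and this extension has derivative `0` off a countable set. -/
theorem eq_of_hasDeltaDeriv_zero (hT : IsClosed T) (ha : IsLeast T a) {K : ℝ → ℝ} {D : Set ℝ}
    (hK : ContinuousOn K T) (hD : (kappaSet T \ D).Countable)
    (hscat : ∀ t ∈ kappaSet T \ D, ¬ t < forwardJump T t)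
    (hder : ∀ t ∈ D, HasDeltaDeriv T K 0 t) {b : ℝ} (hb : b ∈ T) : K b = K a := by
  have hρ := backwardJump_mem hT ha
  have hKρ : ∀ t ∈ T, K (backwardJump T t) = K t := by
    intro t ht
    rcases (backwardJump_le ha (ha.2 ht)).eq_or_lt with e | e
    · rw [e]
    have hκ := mem_kappaSet_of_lt (hρ t) ht e
    have hσ := forwardJump_backwardJump ht e
    have hmem : backwardJump T t ∈ D := by
      by_contra hn
      exact hscat _ ⟨hκ, hn⟩ (by rwa [hσ])
    have := (hder _ hmem).apply_forwardJump (hρ t)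
    rw [hσ] at this
    linarith
  -- Near a point `r` of `T`, the extension only takes values of `K` at points nearer to `r`.
  have key : ∀ r ∈ T, ∀ y, a ≤ y → ∃ τ ∈ T, |τ - r| ≤ |y - r| ∧ K (backwardJump T y) = K τ := by
    intro r hr y hy
    rcases lt_or_ge r y with h | h
    · refine ⟨_, hρ y, ?_, rfl⟩
      have h1 := le_backwardJump hr h
      have h2 := backwardJump_le ha hy
      rw [abs_of_nonneg (by linarith), abs_of_nonneg (by linarith)]
      linarith
    · have hne : (T ∩ Ici y).Nonempty := ⟨r, hr, h⟩
      have hbd : BddBelow (T ∩ Ici y) := ⟨y, fun s hs => hs.2⟩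
      have hmem := (hT.inter isClosed_Ici).csInf_mem hne hbd
      set τ := sInf (T ∩ Ici y) with hτ
      have h1 : τ ≤ r := csInf_le hbd ⟨hr, h⟩
      refine ⟨τ, hmem.1, ?_, ?_⟩
      · have h2 : y ≤ τ := hmem.2
        rw [abs_of_nonpos (by linarith), abs_of_nonpos (by linarith)]
        linarith
      · rw [← hKρ τ hmem.1]
        congr 1
        refine le_antisymm (monotone_backwardJump hT ha hmem.2)
          (backwardJump_le_of_forall ha (ha.2 (hρ y)) fun s hs hsτ => le_backwardJump hs ?_)
        exact not_le.1 fun hys => hsτ.not_ge (csInf_le hbd ⟨hs, hys⟩)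
  have hgap : ∀ r ∉ T, ∀ᶠ y in 𝓝 r, K (backwardJump T y) = K (backwardJump T r) := by
    intro r hr
    obtain ⟨δ, hδ, h⟩ := Metric.isOpen_iff.1 hT.isOpen_compl r hr
    filter_upwards [Metric.ball_mem_nhds r hδ] with y hy
    have aux : ∀ x ∈ Metric.ball r δ, ∀ z ∈ Metric.ball r δ,
        backwardJump T x ≤ backwardJump T z := by
      intro x hx z hz
      refine backwardJump_le_of_forall ha (ha.2 (hρ z)) fun s hs hsx => le_backwardJump hs ?_
      by_contra! hzs
      refine h ?_ hs
      rw [Real.ball_eq_Ioo] at *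
      exact ⟨hz.1.trans_le hzs, hsx.trans hx.2⟩
    have hr' := Metric.mem_ball_self (x := r) hδ
    rw [le_antisymm (aux y hy r hr') (aux r hr' y hy)]
  have hcont : ContinuousOn (fun y => K (backwardJump T y)) (Icc a b) := by
    intro r hrab
    by_cases hr : r ∈ T
    · rw [Metric.continuousWithinAt_iff]
      intro ε hε
      obtain ⟨δ, hδ, h⟩ := Metric.continuousWithinAt_iff.1 (hK r hr) ε hε
      refine ⟨δ, hδ, fun y hy hyr => ?_⟩
      obtain ⟨τ, hτ, hle, he⟩ := key r hr y hy.1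
      simp only [he, hKρ r hr]
      exact h hτ (hle.trans_lt hyr)
    · exact (continuousAt_const.congr
        ((hgap r hr).mono fun y hy => hy.symm)).continuousWithinAt
  -- A right-scattered, left-dense point of `T` may be a point of non-differentiability of the
  -- extension, since the delta derivative there compares `K s` with `K (σ t)` at a positive
  -- distance; there are only countably many such points.
  have hderiv : ∀ r ∈ Ioo a b \ ((kappaSet T \ D) ∪ {t ∈ T | t < forwardJump T t}),
      HasDerivAt (fun y => K (backwardJump T y)) 0 r := by
    rintro r ⟨hrab, hr⟩
    by_cases hrT : r ∈ T
    · have hκ := mem_kappaSet_of_lt hrT hb hrab.2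
      have hrD : r ∈ D := by
        by_contra hn
        exact hr (Or.inl ⟨hκ, hn⟩)
      have hσ : forwardJump T r = r :=
        le_antisymm (not_lt.1 fun h => hr (Or.inr ⟨hrT, h⟩)) (le_forwardJump hT hrT)
      rw [hasDerivAt_iff_isLittleO, Asymptotics.isLittleO_iff]
      intro ε hε
      obtain ⟨δ, hδ, h⟩ := hder r hrD ε hε
      rw [hσ] at h
      filter_upwards [Metric.ball_mem_nhds r hδ, Ioi_mem_nhds hrab.1] with y hy hay
      obtain ⟨τ, hτ, hle, he⟩ := key r hrT y (le_of_lt hay)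
      rw [Metric.mem_ball, Real.dist_eq] at hy
      have hτr := abs_lt.1 (hle.trans_lt hy)
      simp only [he, hKρ r hrT, smul_zero, sub_zero, Real.norm_eq_abs]
      rcases eq_or_ne τ r with e | e
      · rw [e, sub_self, abs_zero]; positivity
      · have := h τ ⟨⟨by linarith [hτr.1], by linarith [hτr.2]⟩, hτ⟩ e
        rw [zero_mul, sub_zero, abs_sub_comm, abs_sub_comm r] at this
        exact this.trans (by gcongr)
    · exact (hasDerivAt_const r _).congr_of_eventuallyEq (hgap r hrT)
  have hfin := integral_eq_of_hasDerivAt_off_countable_of_le (fun y => K (backwardJump T y))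
    (fun _ => (0 : ℝ)) (ha.2 hb) (hD.union (countable_rightScattered T)) hcont hderiv
    intervalIntegrable_const
  simp only [intervalIntegral.integral_zero, hKρ b hb, hKρ a ha.1] at hfin
  linarith

lemma _root_.IsPreAntiderivative.sub_eq (hT : IsClosed T) (ha : IsLeast T a)
    (hf : ContinuousOn f T) {F : ℝ → ℝ} (hF : IsPreAntiderivative T f F) {t : ℝ} (ht : t ∈ T) :
    F t - F a = ∫ r in a..t, f (backwardJump T r) := by
  obtain ⟨hc, D, hDκ, hD, hscat, hder⟩ := hF
  have := eq_of_hasDeltaDeriv_zero hT ha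
    (K := fun t => F t - ∫ r in a..t, f (backwardJump T r))
    (hc.sub (continuous_primitive_comp_backwardJump hT ha hf).continuousOn) hD hscat
    (fun t ht => by
      simpa using (hder t ht).sub (hasDeltaDeriv_primitive hT ha hf (kappaSet_subset T (hDκ ht)))) ht
  simp only [integral_same] at this
  linarith

theorem deltaIntegral_eq (hT : IsClosed T) (ha : IsLeast T a) (hf : ContinuousOn f T) {t : ℝ}
    (ht : t ∈ T) : deltaIntegral T f a t = ∫ r in a..t, f (backwardJump T r) := by
  have h : ∃ F : ℝ → ℝ, IsPreAntiderivative T f F := ⟨_, isPreAntiderivative_primitive hT ha hf⟩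
  rw [deltaIntegral, dif_pos h]
  exact h.choose_spec.sub_eq hT ha hf ht

end Primitive

/-! ### Grönwall's inequality -/

section Gronwall

variable {T : Set ℝ} {a : ℝ} {p : ℝ → ℝ}

/-- Grönwall's inequality in homogeneous form. With `M(r) = ∫_a^r q⁺(ρ(s)) ds` and a bound `C` for
`p`, the hypothesis gives `q ≤ C M` on `T`, hence `M(r) ≤ C ∫_a^r M`, and the classical inequality
applies to `r ↦ ∫_a^r M`. -/
theorem nonpos_of_le_integral (hT : IsClosed T) (ha : IsLeast T a) (hp : ContinuousOn p T)
    (hp0 : ∀ t ∈ T, 0 ≤ p t) {q : ℝ → ℝ} (hq : ContinuousOn q T)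
    (h : ∀ t ∈ T, q t ≤ ∫ r in a..t, p (backwardJump T r) * q (backwardJump T r))
    {b : ℝ} (hb : b ∈ T) : q b ≤ 0 := by
  obtain ⟨C, hC0, hC⟩ := exists_bound hT hp a b
  have hρ := backwardJump_mem hT ha
  have hq' : ContinuousOn (fun t => max (q t) 0) T := hq.sup continuousOn_const
  have hint := intervalIntegrable_comp_backwardJump hT ha hq'
  set M : ℝ → ℝ := fun r => ∫ s in a..r, max (q (backwardJump T s)) 0 with hM
  have hMc : Continuous M := continuous_primitive_comp_backwardJump hT ha hq'
  have hMmono : ∀ r s, a ≤ r → r ≤ s → M r ≤ M s := fun r s har hrs =>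
    integral_mono_interval le_rfl har hrs
      (Eventually.of_forall fun _ => le_max_right _ _) (hint _ _)
  have hM0 : ∀ r, a ≤ r → 0 ≤ M r := fun r har =>
    integral_nonneg har fun _ _ => le_max_right _ _
  have hqM : ∀ t ∈ T, t ≤ b → q t ≤ C * M t := by
    intro t ht htb
    refine (h t ht).trans ?_
    rw [hM, ← intervalIntegral.integral_const_mul]
    refine integral_mono_on (ha.2 ht)
      (intervalIntegrable_comp_backwardJump hT ha (hp.fun_mul hq) _ _) ((hint _ _).const_mul C)
      fun r hr => ?_
    have hrb := (backwardJump_le ha hr.1).trans (hr.2.trans htb)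
    calc _ ≤ p (backwardJump T r) * max (q (backwardJump T r)) 0 :=
          mul_le_mul_of_nonneg_left (le_max_left _ _) (hp0 _ (hρ r))
      _ ≤ _ := mul_le_mul_of_nonneg_right
          ((le_abs_self _).trans (hC _ (hρ r) ⟨ha.2 (hρ r), hrb⟩)) (le_max_right _ _)
  have hMi : ∀ x y, IntervalIntegrable M volume x y := fun x y => hMc.intervalIntegrable x y
  have hMN : ∀ r, a ≤ r → r ≤ b → M r ≤ C * ∫ s in a..r, M s := by
    intro r har hrb
    rw [← intervalIntegral.integral_const_mul]
    refine integral_mono_on har (hint _ _) ((hMi _ _).const_mul C) fun s hs => ?_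
    have hsρ := backwardJump_le ha hs.1
    have hle := hMmono _ _ (ha.2 (hρ s)) hsρ
    refine max_le ((hqM _ (hρ s) (hsρ.trans (hs.2.trans hrb))).trans ?_)
      (mul_nonneg hC0 (hM0 s hs.1))
    gcongr
  have hab := ha.2 hb
  have hN := eq_zero_of_abs_deriv_le_mul_abs_self_of_eq_zero_right
    (f := fun r => ∫ s in a..r, M s) (f' := M) (K := C) (a := a) (b := b)
    (continuous_primitive hMi a).continuousOn
    (fun r _ => (integral_hasDerivAt_right (hMi _ _)
      hMc.stronglyMeasurable.stronglyMeasurableAtFilter hMc.continuousAt).hasDerivWithinAt)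
    integral_same
    (fun r hr => by
      rw [Real.norm_of_nonneg (hM0 r hr.1), Real.norm_of_nonneg
        (integral_nonneg hr.1 fun s hs => hM0 s hs.1)]
      exact hMN r hr.1 hr.2.le) b ⟨hab, le_rfl⟩
  have h1 := hMN b hab le_rfl
  rw [hN, mul_zero] at h1
  exact (hqM b hb le_rfl).trans (mul_nonpos_of_nonneg_of_nonpos hC0 h1)

end Gronwall

/-! ### The exponential function -/

section Exp

variable {T : Set ℝ} {a : ℝ} {p : ℝ → ℝ}

/-- The terms of the Volterra (Picard iteration) series of the equation `x^Δ = p x`,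
`x(a) = 1`: `x₀ = 1` and `xₙ₊₁(t) = ∫_a^t p(ρ(r)) xₙ(ρ(r)) dr`. -/
noncomputable def expTerm (T : Set ℝ) (p : ℝ → ℝ) (a : ℝ) : ℕ → ℝ → ℝ
  | 0 => fun _ => 1
  | n + 1 => fun t => ∫ r in a..t, p (backwardJump T r) * expTerm T p a n (backwardJump T r)

lemma continuous_expTerm (hT : IsClosed T) (ha : IsLeast T a) (hp : ContinuousOn p T) (n : ℕ) :
    Continuous (expTerm T p a n) := by
  induction n with
  | zero => exact continuous_const
  | succ n ih =>
    exact continuous_primitive_comp_backwardJump hT ha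
      (f := fun t => p t * expTerm T p a n t) (hp.fun_mul ih.continuousOn)

lemma abs_expTerm_le (hT : IsClosed T) (ha : IsLeast T a)
    {b C : ℝ} (hC : ∀ t ∈ T, t ∈ Icc a b → |p t| ≤ C) (hC0 : 0 ≤ C) (n : ℕ) {t : ℝ}
    (ht : t ∈ Icc a b) : |expTerm T p a n t| ≤ (C * (t - a)) ^ n / n.factorial := by
  induction n generalizing t with
  | zero => simp [expTerm]
  | succ n ih =>
    have hd : ∀ r ∈ uIcc a t, HasDerivAt (fun r => (C * (r - a)) ^ (n + 1) / (n + 1).factorial)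
        (C * ((C * (r - a)) ^ n / n.factorial)) r := by
      intro r _
      have h := (((((hasDerivAt_id r).sub_const a).const_mul C).pow (n + 1)).div_const
        ((n + 1).factorial : ℝ))
      refine h.congr_deriv ?_
      have : (n.factorial : ℝ) ≠ 0 := by positivity
      push_cast [Nat.factorial_succ]
      simp only [id]
      field_simp
    have hcont : Continuous fun r => C * ((C * (r - a)) ^ n / n.factorial) := by fun_prop
    have he := integral_eq_sub_of_hasDerivAt hd (hcont.intervalIntegrable _ _)
    simp only [sub_self, mul_zero, zero_pow (Nat.succ_ne_zero n), zero_div, sub_zero] at he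
    rw [← he, ← Real.norm_eq_abs]
    refine norm_integral_le_of_norm_le ht.1 (Eventually.of_forall fun r hr => ?_)
      (hcont.intervalIntegrable _ _)
    have hρ := backwardJump_mem hT ha r
    have h1 := ha.2 hρ
    have h2 := backwardJump_le ha hr.1.le
    have hm : backwardJump T r ∈ Icc a b := ⟨h1, h2.trans (hr.2.trans ht.2)⟩
    rw [norm_mul]
    refine mul_le_mul (hC _ hρ hm) ((ih hm).trans ?_) (norm_nonneg _) hC0
    have h3 : 0 ≤ C * (backwardJump T r - a) := mul_nonneg hC0 (by linarith)
    gcongr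

/-- The integral equation of the exponential function has a continuous solution. -/
theorem exists_integral_eq (hT : IsClosed T) (ha : IsLeast T a) (hp : ContinuousOn p T) :
    ∃ x : ℝ → ℝ, ContinuousOn x T ∧
      ∀ t ∈ T, x t = 1 + ∫ r in a..t, p (backwardJump T r) * x (backwardJump T r) := by
  have hbound : ∀ b, ∃ C, 0 ≤ C ∧ (∀ t ∈ T, t ∈ Icc a b → |p t| ≤ C) ∧
      ∀ n, ∀ t ∈ Icc a b, ‖expTerm T p a n t‖ ≤ (C * (b - a)) ^ n / n.factorial := by
    intro b
    obtain ⟨C, hC0, hC⟩ := exists_bound hT hp a b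
    refine ⟨C, hC0, hC, fun n t ht => (abs_expTerm_le hT ha hC hC0 n ht).trans ?_⟩
    have h3 : 0 ≤ C * (t - a) := mul_nonneg hC0 (sub_nonneg.2 ht.1)
    have := ht.2
    gcongr
  have hcont := continuous_expTerm hT ha hp
  refine ⟨fun t => ∑' n, expTerm T p a n t, fun t ht => ?_, fun t ht => ?_⟩
  · obtain ⟨C, -, -, hC⟩ := hbound (t + 1)
    have h := continuousOn_tsum (fun n => (hcont n).continuousOn)
      (Real.summable_pow_div_factorial (C * (t + 1 - a))) hC
    refine (h t ⟨ha.2 ht, by linarith⟩).mono_of_mem_nhdsWithin ?_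
    filter_upwards [self_mem_nhdsWithin,
      nhdsWithin_le_nhds (Iic_mem_nhds (lt_add_one t))] with s hs hs'
    exact ⟨ha.2 hs, hs'⟩
  · obtain ⟨C, hC0, hpC, hC⟩ := hbound t
    have hsum : ∀ s ∈ Icc a t, Summable fun n => expTerm T p a n s := fun s hs =>
      Summable.of_norm_bounded (Real.summable_pow_div_factorial _) fun n => hC n s hs
    have hρ : ∀ r ∈ uIoc a t, backwardJump T r ∈ Icc a t := by
      intro r hr
      rw [uIoc_of_le (ha.2 ht)] at hr
      exact ⟨ha.2 (backwardJump_mem hT ha r), (backwardJump_le ha hr.1.le).trans hr.2⟩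
    have hs := hasSum_integral_of_dominated_convergence (μ := volume) (a := a) (b := t)
      (F := fun n r => p (backwardJump T r) * expTerm T p a n (backwardJump T r))
      (f := fun r => p (backwardJump T r) * ∑' n, expTerm T p a n (backwardJump T r))
      (fun n _ => C * ((C * (t - a)) ^ n / n.factorial))
      (fun n => (measurable_comp_backwardJump hT ha
        (hp.fun_mul (hcont n).continuousOn)).aestronglyMeasurable)
      (fun n => Eventually.of_forall fun r hr => by
        rw [norm_mul]
        exact mul_le_mul (hpC _ (backwardJump_mem hT ha r) (hρ r hr)) (hC n _ (hρ r hr))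
          (norm_nonneg _) hC0)
      (Eventually.of_forall fun r _ => (Real.summable_pow_div_factorial _).mul_left C)
      intervalIntegrable_const
      (Eventually.of_forall fun r hr => (hsum _ (hρ r hr)).hasSum.mul_left _)
    beta_reduce
    rw [← hs.tsum_eq, (hsum t ⟨ha.2 ht, le_rfl⟩).tsum_eq_zero_add]
    rfl

lemma _root_.HasDeltaDeriv.continuousWithinAt {x : ℝ → ℝ} {d t : ℝ} (ht : t ∈ T)
    (hx : HasDeltaDeriv T x d t) : ContinuousWithinAt x T t := by
  have hσ := hx.apply_forwardJump ht
  set σ := forwardJump T t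
  rw [Metric.continuousWithinAt_iff]
  intro ε hε
  -- For `|s - t| ≤ 1`, the error `|x s - x t|` is at most `η (|σ - t| + 1) + |d| |s - t|`, where
  -- `η` is the accuracy in the delta derivative; `η = |s - t| = ε / (2 B)` makes it `ε / 2`.
  set B := |σ - t| + 1 + |d| with hB
  have hBpos : 0 < B := by positivity
  obtain ⟨δ, hδ, h⟩ := hx (ε / (2 * B)) (by positivity)
  refine ⟨min δ (min 1 (ε / (2 * B))), by positivity, fun s hs hst => ?_⟩
  rw [Real.dist_eq] at hst ⊢
  have hs1 : |s - t| < δ := hst.trans_le (min_le_left _ _)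
  have hs2 : |s - t| < 1 := hst.trans_le ((min_le_right _ _).trans (min_le_left _ _))
  have hs3 : |s - t| < ε / (2 * B) :=
    hst.trans_le ((min_le_right _ _).trans (min_le_right _ _))
  have h1 : |x σ - x s - d * (σ - s)| ≤ ε / (2 * B) * |σ - s| := by
    by_cases hne : s = σ
    · simp [hne]
    · have := abs_lt.1 hs1
      exact h s ⟨⟨by linarith, by linarith⟩, hs⟩ hne
  have h2 : |σ - s| ≤ |σ - t| + 1 := by
    have := abs_sub_le σ t s
    rw [abs_sub_comm t s] at this
    linarith
  have e : x s - x t = d * (s - t) - (x σ - x s - d * (σ - s)) := by rw [hσ]; ring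
  calc |x s - x t| ≤ |d * (s - t)| + |x σ - x s - d * (σ - s)| := by rw [e]; exact abs_sub _ _
    _ ≤ |d| * |s - t| + ε / (2 * B) * (|σ - t| + 1) := by
        rw [abs_mul]
        gcongr
        exact h1.trans (by gcongr)
    _ ≤ |d| * (ε / (2 * B)) + ε / (2 * B) * (|σ - t| + 1) := by gcongr
    _ = ε / 2 := by field_simp; rw [hB]; ring
    _ < ε := half_lt_self hε

/-- A point outside `T^κ` is a left-scattered maximum, so it is isolated in `T`. -/
lemma continuousWithinAt_of_notMem_kappaSet {x : ℝ → ℝ} {t : ℝ} (ht : t ∈ T)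
    (htκ : t ∉ kappaSet T) : ContinuousWithinAt x T t := by
  have hbd : BddAbove T := by
    by_contra h
    exact htκ (by rwa [kappaSet, if_neg h])
  rw [kappaSet, if_pos hbd, Set.mem_sdiff, not_and, not_not] at htκ
  have hlt := (htκ ht).1
  have hmax : t = sSup T := by
    refine le_antisymm (htκ ht).2 (not_lt.1 fun h => hlt.not_ge (le_backwardJump ht h))
  refine continuousWithinAt_const.congr_of_eventuallyEq (f := fun _ => x t) ?_ rfl
  filter_upwards [self_mem_nhdsWithin, nhdsWithin_le_nhds (Ioi_mem_nhds hlt)] with s hs hs'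
  congr 1
  refine le_antisymm (hmax ▸ le_csSup hbd hs) (hmax ▸ not_lt.1 fun h => ?_)
  exact (le_backwardJump hs h).not_gt hs'

lemma _root_.IsDeltaExpSolution.continuousOn {x : ℝ → ℝ} (hx : IsDeltaExpSolution T p a x) :
    ContinuousOn x T := by
  intro t ht
  by_cases htκ : t ∈ kappaSet T
  · exact (hx.2 t htκ).continuousWithinAt ht
  · exact continuousWithinAt_of_notMem_kappaSet ht htκ

/-- `e_p(·, a)` is a genuine solution of its integral equation, not the default value. -/
theorem deltaExp_spec (hT : IsClosed T) (ha : IsLeast T a) (hp : ContinuousOn p T) :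
    ContinuousOn (fun t => deltaExp T p t a) T ∧ ∀ t ∈ T, deltaExp T p t a =
      1 + ∫ r in a..t, p (backwardJump T r) * deltaExp T p (backwardJump T r) a := by
  have hex : ∃ x : ℝ → ℝ, IsDeltaExpSolution T p a x := by
    obtain ⟨x, hx, he⟩ := exists_integral_eq hT ha hp
    refine ⟨fun t => 1 + ∫ r in a..t, p (backwardJump T r) * x (backwardJump T r), by simp,
      fun t ht => ?_⟩
    have htT := kappaSet_subset T ht
    have h := hasDeltaDeriv_primitive hT ha (hp.fun_mul hx) htT
    intro ε hε
    obtain ⟨δ, hδ, h⟩ := h ε hε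
    refine ⟨δ, hδ, fun s hs hne => ?_⟩
    beta_reduce
    rw [← he t htT, add_sub_add_left_eq_sub]
    exact h s hs hne
  simp only [deltaExp, dif_pos hex]
  have hx := hex.choose_spec
  set x := hex.choose
  refine ⟨hx.continuousOn, fun t ht => ?_⟩
  have hF : IsPreAntiderivative T (fun t => p t * x t) x :=
    ⟨hx.continuousOn, kappaSet T, subset_rfl, by simp, by simp, hx.2⟩
  have := hF.sub_eq hT ha (hp.fun_mul hx.continuousOn) ht
  rw [hx.1] at this
  linarith

/-- Comparison with the exponential function. -/
theorem le_mul_deltaExp (hT : IsClosed T) (ha : IsLeast T a) (hp : ContinuousOn p T)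
    (hp0 : ∀ t ∈ T, 0 ≤ p t) {y : ℝ → ℝ} (hy : ContinuousOn y T) {k : ℝ}
    (h : ∀ t ∈ T, y t ≤ k + ∫ r in a..t, p (backwardJump T r) * y (backwardJump T r))
    {t : ℝ} (ht : t ∈ T) : y t ≤ k * deltaExp T p t a := by
  obtain ⟨hc, he⟩ := deltaExp_spec hT ha hp
  have hc' : ContinuousOn (fun t => k * deltaExp T p t a) T := continuousOn_const.mul hc
  have := nonpos_of_le_integral hT ha hp hp0 (hy.fun_sub hc') (fun t ht => by
    have e : (∫ r in a..t, p (backwardJump T r) *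
        (y (backwardJump T r) - k * deltaExp T p (backwardJump T r) a))
        = (∫ r in a..t, p (backwardJump T r) * y (backwardJump T r)) - k *
          ∫ r in a..t, p (backwardJump T r) * deltaExp T p (backwardJump T r) a := by
      rw [← intervalIntegral.integral_const_mul, ← integral_sub
        (intervalIntegrable_comp_backwardJump hT ha (hp.fun_mul hy) _ _)
        ((intervalIntegrable_comp_backwardJump hT ha (hp.fun_mul hc) _ _).const_mul k)]
      congr 1
      ext r
      ring
    rw [e]
    have h1 := h t ht
    have h2 := he t ht
    linear_combination h1 - k * h2) ht
  simpa using this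

/-- Since `e_p` is nondecreasing, `e_p(t) = 1 + ∫ p e_p ≤ 1 + e_p(t) ∫ p`. -/
theorem deltaExp_le (hT : IsClosed T) (ha : IsLeast T a) (hp : ContinuousOn p T)
    (hp0 : ∀ t ∈ T, 0 ≤ p t) {t : ℝ} (ht : t ∈ T) :
    deltaExp T p t a ≤ 1 + (∫ r in a..t, p (backwardJump T r)) * deltaExp T p t a := by
  obtain ⟨hc, he⟩ := deltaExp_spec hT ha hp
  have hρ := backwardJump_mem hT ha
  have hpos : ∀ s ∈ T, 0 ≤ deltaExp T p s a := fun s hs => by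
    have := le_mul_deltaExp hT ha hp hp0 (y := fun _ => 0) continuousOn_const (k := 1)
      (fun _ _ => by simp) hs
    simpa using this
  have hint := intervalIntegrable_comp_backwardJump hT ha (hp.fun_mul hc)
  have hmono : ∀ s ∈ T, s ≤ t → deltaExp T p s a ≤ deltaExp T p t a := by
    intro s hs hst
    rw [he s hs, he t ht]
    exact add_le_add_right (integral_mono_interval le_rfl (ha.2 hs) hst
      (Eventually.of_forall fun r => mul_nonneg (hp0 _ (hρ r)) (hpos _ (hρ r))) (hint _ _)) 1
  conv_lhs => rw [he t ht]
  rw [← intervalIntegral.integral_mul_const]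
  refine add_le_add_right (integral_mono_on (ha.2 ht) (hint _ _)
    ((intervalIntegrable_comp_backwardJump hT ha hp _ _).mul_const _) fun r hr => ?_) 1
  exact mul_le_mul_of_nonneg_left
    (hmono _ (hρ r) ((backwardJump_le ha hr.1).trans hr.2)) (hp0 _ (hρ r))

end Exp

/-! ### Iterated integrals -/

section Iterated

variable {S₁ S₂ : Set ℝ} {a₁ a₂ : ℝ} {f g : ℝ → ℝ → ℝ}

lemma continuousOn_slice (hf : ContinuousOn (Function.uncurry f) (S₁ ×ˢ S₂)) {s : ℝ}
    (hs : s ∈ S₁) : ContinuousOn (f s) S₂ :=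
  hf.comp (f := fun r => (s, r)) (by fun_prop) fun _ hr => ⟨hs, hr⟩

lemma continuousOn_integral_slice (hS₁ : IsClosed S₁) (hS₂ : IsClosed S₂) (ha₂ : IsLeast S₂ a₂)
    (hf : ContinuousOn (Function.uncurry f) (S₁ ×ˢ S₂)) {t : ℝ} (hat : a₂ ≤ t) :
    ContinuousOn (fun s => ∫ r in a₂..t, f s (backwardJump S₂ r)) S₁ := by
  intro s hs
  obtain ⟨C, hC⟩ := ((isCompact_Icc (a := s - 1) (b := s + 1)).inter_left hS₁).prod
    ((isCompact_Icc (a := a₂) (b := t)).inter_left hS₂) |>.exists_bound_of_continuousOn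
    (hf.mono (prod_mono inter_subset_left inter_subset_left))
  have hρ := backwardJump_mem hS₂ ha₂
  refine continuousWithinAt_of_dominated_interval (bound := fun _ => C) ?_ ?_
    intervalIntegrable_const ?_
  · filter_upwards [self_mem_nhdsWithin] with y hy
    exact (measurable_comp_backwardJump hS₂ ha₂ (continuousOn_slice hf hy)).aestronglyMeasurable
  · filter_upwards [self_mem_nhdsWithin, nhdsWithin_le_nhds
      (Icc_mem_nhds (sub_one_lt s) (lt_add_one s))] with y hy hys
    refine Eventually.of_forall fun r hr => ?_
    rw [uIoc_of_le hat] at hr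
    exact hC (y, backwardJump S₂ r) ⟨⟨hy, hys⟩, hρ r, ha₂.2 (hρ r),
      (backwardJump_le ha₂ hr.1.le).trans hr.2⟩
  · refine Eventually.of_forall fun r _ => ?_
    exact (hf (s, backwardJump S₂ r) ⟨hs, hρ r⟩).comp (f := fun y => (y, backwardJump S₂ r))
      (by fun_prop) fun y hy => ⟨hy, hρ r⟩

/-- The iterated integral `∫_{a₁}^{t₁} ∫_{a₂}^{t₂} f(ρ₁(s), ρ₂(r)) dr ds`, to which the iterated
delta integral of a continuous function reduces. -/
noncomputable def iteratedIntegral (S₁ S₂ : Set ℝ) (a₁ a₂ : ℝ) (f : ℝ → ℝ → ℝ) (t₁ t₂ : ℝ) : ℝ :=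
  ∫ s in a₁..t₁, ∫ r in a₂..t₂, f (backwardJump S₁ s) (backwardJump S₂ r)

lemma deltaIntegral₂_eq (hS₁ : IsClosed S₁) (hS₂ : IsClosed S₂) (ha₁ : IsLeast S₁ 0)
    (ha₂ : IsLeast S₂ 0) (hf : ContinuousOn (Function.uncurry f) (S₁ ×ˢ S₂)) {t₁ t₂ : ℝ}
    (ht₁ : t₁ ∈ S₁) (ht₂ : t₂ ∈ S₂) :
    deltaIntegral₂ S₁ S₂ f t₁ t₂ = iteratedIntegral S₁ S₂ 0 0 f t₁ t₂ := by
  have h : ∀ s ∈ S₁, deltaIntegral S₂ (fun r => f s r) 0 t₂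
      = ∫ r in 0..t₂, f s (backwardJump S₂ r) := fun s hs =>
    deltaIntegral_eq hS₂ ha₂ (continuousOn_slice hf hs) ht₂
  rw [deltaIntegral₂, deltaIntegral_eq hS₁ ha₁
    ((continuousOn_integral_slice hS₁ hS₂ ha₂ hf (ha₂.2 ht₂)).congr h) ht₁]
  exact integral_congr fun s _ => h _ (backwardJump_mem hS₁ ha₁ s)

lemma iteratedIntegral_add (hS₁ : IsClosed S₁) (hS₂ : IsClosed S₂) (ha₁ : IsLeast S₁ a₁)
    (ha₂ : IsLeast S₂ a₂) (hf : ContinuousOn (Function.uncurry f) (S₁ ×ˢ S₂))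
    (hg : ContinuousOn (Function.uncurry g) (S₁ ×ˢ S₂)) {t₁ t₂ : ℝ} (ht₂ : a₂ ≤ t₂) :
    iteratedIntegral S₁ S₂ a₁ a₂ (fun s r => f s r + g s r) t₁ t₂ =
      iteratedIntegral S₁ S₂ a₁ a₂ f t₁ t₂ + iteratedIntegral S₁ S₂ a₁ a₂ g t₁ t₂ := by
  unfold iteratedIntegral
  rw [← integral_add
    (intervalIntegrable_comp_backwardJump hS₁ ha₁
      (continuousOn_integral_slice hS₁ hS₂ ha₂ hf ht₂) _ _)
    (intervalIntegrable_comp_backwardJump hS₁ ha₁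
      (continuousOn_integral_slice hS₁ hS₂ ha₂ hg ht₂) _ _)]
  refine integral_congr fun s _ => integral_add ?_ ?_
  · exact intervalIntegrable_comp_backwardJump hS₂ ha₂
      (continuousOn_slice hf (backwardJump_mem hS₁ ha₁ s)) _ _
  · exact intervalIntegrable_comp_backwardJump hS₂ ha₂
      (continuousOn_slice hg (backwardJump_mem hS₁ ha₁ s)) _ _

lemma iteratedIntegral_mono (hS₁ : IsClosed S₁) (hS₂ : IsClosed S₂) (ha₁ : IsLeast S₁ a₁)
    (ha₂ : IsLeast S₂ a₂) (hf : ContinuousOn (Function.uncurry f) (S₁ ×ˢ S₂))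
    (hg : ContinuousOn (Function.uncurry g) (S₁ ×ˢ S₂))
    (h : ∀ s ∈ S₁, ∀ r ∈ S₂, f s r ≤ g s r) {t₁ t₂ : ℝ} (ht₁ : a₁ ≤ t₁) (ht₂ : a₂ ≤ t₂) :
    iteratedIntegral S₁ S₂ a₁ a₂ f t₁ t₂ ≤ iteratedIntegral S₁ S₂ a₁ a₂ g t₁ t₂ := by
  refine intervalIntegral.integral_mono ht₁
    (intervalIntegrable_comp_backwardJump hS₁ ha₁
      (continuousOn_integral_slice hS₁ hS₂ ha₂ hf ht₂) _ _)
    (intervalIntegrable_comp_backwardJump hS₁ ha₁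
      (continuousOn_integral_slice hS₁ hS₂ ha₂ hg ht₂) _ _) fun s => ?_
  have hs := backwardJump_mem hS₁ ha₁ s
  exact intervalIntegral.integral_mono ht₂
    (intervalIntegrable_comp_backwardJump hS₂ ha₂ (continuousOn_slice hf hs) _ _)
    (intervalIntegrable_comp_backwardJump hS₂ ha₂ (continuousOn_slice hg hs) _ _)
    fun r => h _ hs _ (backwardJump_mem hS₂ ha₂ r)

lemma iteratedIntegral_mono_right (hS₁ : IsClosed S₁) (hS₂ : IsClosed S₂) (ha₁ : IsLeast S₁ a₁)
    (ha₂ : IsLeast S₂ a₂) (hf : ContinuousOn (Function.uncurry f) (S₁ ×ˢ S₂))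
    (h : ∀ s ∈ S₁, ∀ r ∈ S₂, 0 ≤ f s r) {t₁ t₂ t₂' : ℝ} (ht₁ : a₁ ≤ t₁) (ht₂ : a₂ ≤ t₂)
    (hle : t₂ ≤ t₂') :
    iteratedIntegral S₁ S₂ a₁ a₂ f t₁ t₂ ≤ iteratedIntegral S₁ S₂ a₁ a₂ f t₁ t₂' := by
  refine intervalIntegral.integral_mono ht₁
    (intervalIntegrable_comp_backwardJump hS₁ ha₁
      (continuousOn_integral_slice hS₁ hS₂ ha₂ hf ht₂) _ _)
    (intervalIntegrable_comp_backwardJump hS₁ ha₁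
      (continuousOn_integral_slice hS₁ hS₂ ha₂ hf (ht₂.trans hle)) _ _) fun s => ?_
  have hs := backwardJump_mem hS₁ ha₁ s
  exact integral_mono_interval le_rfl ht₂ hle
    (Eventually.of_forall fun r => h _ hs _ (backwardJump_mem hS₂ ha₂ r))
    (intervalIntegrable_comp_backwardJump hS₂ ha₂ (continuousOn_slice hf hs) _ _)

end Iterated

/-! ### The inequality for one unknown function -/

/-- A Wendroff-type inequality. The right-hand side `y = k + ∬ H w` is nondecreasing in the second
variable, so for fixed `t₂` it satisfies the one-variable inequality `y ≤ k + ∫ p y` with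
`p = ∫_{a₂}^{t₂} H(·, r) Δr`. -/
theorem le_add_mul_deltaExp {S₁ S₂ : Set ℝ} {a₁ a₂ : ℝ} (hS₁ : IsClosed S₁) (hS₂ : IsClosed S₂)
    (ha₁ : IsLeast S₁ a₁) (ha₂ : IsLeast S₂ a₂) {H w : ℝ → ℝ → ℝ} {k : ℝ} (hk : 0 ≤ k)
    (hH : ContinuousOn (Function.uncurry H) (S₁ ×ˢ S₂))
    (hw : ContinuousOn (Function.uncurry w) (S₁ ×ˢ S₂))
    (hH0 : ∀ s ∈ S₁, ∀ r ∈ S₂, 0 ≤ H s r) (hw0 : ∀ s ∈ S₁, ∀ r ∈ S₂, 0 ≤ w s r)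
    (h : ∀ s ∈ S₁, ∀ r ∈ S₂,
      w s r ≤ k + iteratedIntegral S₁ S₂ a₁ a₂ (fun s r => H s r * w s r) s r)
    {p : ℝ → ℝ} {t₁ t₂ : ℝ} (ht₁ : t₁ ∈ S₁) (ht₂ : t₂ ∈ S₂)
    (hp : ∀ s ∈ S₁, p s = ∫ r in a₂..t₂, H s (backwardJump S₂ r)) :
    w t₁ t₂ ≤ k + k * iteratedIntegral S₁ S₂ a₁ a₂ H t₁ t₂ * deltaExp S₁ p t₁ a₁ := by
  have hat₂ := ha₂.2 ht₂
  have hρ₁ := backwardJump_mem hS₁ ha₁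
  have hρ₂ := backwardJump_mem hS₂ ha₂
  have hHw : ContinuousOn (Function.uncurry fun s r => H s r * w s r) (S₁ ×ˢ S₂) := hH.mul hw
  have hHw0 : ∀ s ∈ S₁, ∀ r ∈ S₂, 0 ≤ H s r * w s r := fun s hs r hr =>
    mul_nonneg (hH0 s hs r hr) (hw0 s hs r hr)
  have hpc : ContinuousOn p S₁ :=
    (continuousOn_integral_slice hS₁ hS₂ ha₂ hH hat₂).congr hp
  have hp0 : ∀ s ∈ S₁, 0 ≤ p s := fun s hs => by
    rw [hp s hs]
    exact integral_nonneg hat₂ fun r _ => hH0 s hs _ (hρ₂ r)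
  set y : ℝ → ℝ := fun s =>
    k + iteratedIntegral S₁ S₂ a₁ a₂ (fun s r => H s r * w s r) s t₂ with hy
  have hgc := continuousOn_integral_slice hS₁ hS₂ ha₂ hHw hat₂
  have hyc : ContinuousOn y S₁ :=
    (continuous_const.add (continuous_primitive_comp_backwardJump hS₁ ha₁ hgc)).continuousOn
  have hg : ∀ s ∈ S₁,
      ∫ r in a₂..t₂, H s (backwardJump S₂ r) * w s (backwardJump S₂ r) ≤ p s * y s := by
    intro s hs
    rw [hp s hs, ← intervalIntegral.integral_mul_const]
    refine integral_mono_on hat₂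
      (intervalIntegrable_comp_backwardJump hS₂ ha₂ (continuousOn_slice hHw hs) _ _)
      ((intervalIntegrable_comp_backwardJump hS₂ ha₂
        (continuousOn_slice hH hs) _ _).mul_const _) fun r hr => ?_
    refine mul_le_mul_of_nonneg_left ((h s hs _ (hρ₂ r)).trans ?_) (hH0 s hs _ (hρ₂ r))
    exact add_le_add_right (iteratedIntegral_mono_right hS₁ hS₂ ha₁ ha₂ hHw hHw0 (ha₁.2 hs)
      (ha₂.2 (hρ₂ r)) ((backwardJump_le ha₂ hr.1).trans hr.2)) k
  have hycomp := le_mul_deltaExp hS₁ ha₁ hpc hp0 hyc (k := k) (fun t ht => by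
    refine add_le_add_right (intervalIntegral.integral_mono (ha₁.2 ht)
      (intervalIntegrable_comp_backwardJump hS₁ ha₁ hgc _ _)
      (intervalIntegrable_comp_backwardJump hS₁ ha₁ (hpc.fun_mul hyc) _ _)
      fun s => hg _ (hρ₁ s)) k) ht₁
  have hI : iteratedIntegral S₁ S₂ a₁ a₂ H t₁ t₂ = ∫ s in a₁..t₁, p (backwardJump S₁ s) :=
    integral_congr fun s _ => (hp _ (hρ₁ s)).symm
  have hexp := mul_le_mul_of_nonneg_left (deltaExp_le hS₁ ha₁ hpc hp0 ht₁) hk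
  rw [hI]
  calc w t₁ t₂ ≤ y t₁ := h t₁ ht₁ t₂ ht₂
    _ ≤ k * deltaExp S₁ p t₁ a₁ := hycomp
    _ ≤ _ := hexp
    _ = _ := by ring

lemma isClosed_nonnegPart {T : Set ℝ} (hT : IsTimeScale T) : IsClosed (nonnegPart T) :=
  isClosed_Ici.inter hT.isClosed

lemma isLeast_nonnegPart {T : Set ℝ} (h0 : (0 : ℝ) ∈ T) : IsLeast (nonnegPart T) 0 :=
  ⟨⟨mem_Ici.2 le_rfl, h0⟩, fun _ ht => ht.1⟩

end TimeScale

/-! ### The inequality for two unknown functions -/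

open TimeScale

theorem theorem6p6
    (T₁ T₂ : Set ℝ) (hT₁ : IsTimeScale T₁) (hT₂ : IsTimeScale T₂)
    (h0₁ : (0 : ℝ) ∈ T₁) (h0₂ : (0 : ℝ) ∈ T₂)
    (hpos₁ : ∃ t ∈ T₁, 0 < t) (hpos₂ : ∃ t ∈ T₂, 0 < t)
    (c₁ c₂ : ℝ) (hc₁ : 0 ≤ c₁) (hc₂ : 0 ≤ c₂)
    (u v h₁ h₂ h₃ h₄ : ℝ → ℝ → ℝ)
    (u_cont : ContinuousOn (Function.uncurry u) (nonnegPart T₁ ×ˢ nonnegPart T₂))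
    (v_cont : ContinuousOn (Function.uncurry v) (nonnegPart T₁ ×ˢ nonnegPart T₂))
    (h₁_cont : ContinuousOn (Function.uncurry h₁) (nonnegPart T₁ ×ˢ nonnegPart T₂))
    (h₂_cont : ContinuousOn (Function.uncurry h₂) (nonnegPart T₁ ×ˢ nonnegPart T₂))
    (h₃_cont : ContinuousOn (Function.uncurry h₃) (nonnegPart T₁ ×ˢ nonnegPart T₂))
    (h₄_cont : ContinuousOn (Function.uncurry h₄) (nonnegPart T₁ ×ˢ nonnegPart T₂))
    (u_nonneg : ∀ t₁ ∈ nonnegPart T₁, ∀ t₂ ∈ nonnegPart T₂, 0 ≤ u t₁ t₂)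
    (v_nonneg : ∀ t₁ ∈ nonnegPart T₁, ∀ t₂ ∈ nonnegPart T₂, 0 ≤ v t₁ t₂)
    (h₁_nonneg : ∀ t₁ ∈ nonnegPart T₁, ∀ t₂ ∈ nonnegPart T₂, 0 ≤ h₁ t₁ t₂)
    (h₂_nonneg : ∀ t₁ ∈ nonnegPart T₁, ∀ t₂ ∈ nonnegPart T₂, 0 ≤ h₂ t₁ t₂)
    (h₃_nonneg : ∀ t₁ ∈ nonnegPart T₁, ∀ t₂ ∈ nonnegPart T₂, 0 ≤ h₃ t₁ t₂)
    (h₄_nonneg : ∀ t₁ ∈ nonnegPart T₁, ∀ t₂ ∈ nonnegPart T₂, 0 ≤ h₄ t₁ t₂)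
    (hu : ∀ t₁ ∈ nonnegPart T₁, ∀ t₂ ∈ nonnegPart T₂,
      u t₁ t₂ ≤ c₁
        + deltaIntegral₂ (nonnegPart T₁) (nonnegPart T₂)
            (fun s₁ s₂ => h₁ s₁ s₂ * u s₁ s₂) t₁ t₂
        + deltaIntegral₂ (nonnegPart T₁) (nonnegPart T₂)
            (fun s₁ s₂ => h₂ s₁ s₂ * v s₁ s₂) t₁ t₂)
    (hv : ∀ t₁ ∈ nonnegPart T₁, ∀ t₂ ∈ nonnegPart T₂,
      v t₁ t₂ ≤ c₂
        + deltaIntegral₂ (nonnegPart T₁) (nonnegPart T₂)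
            (fun s₁ s₂ => h₃ s₁ s₂ * u s₁ s₂) t₁ t₂
        + deltaIntegral₂ (nonnegPart T₁) (nonnegPart T₂)
            (fun s₁ s₂ => h₄ s₁ s₂ * v s₁ s₂) t₁ t₂)
    (c₃ : ℝ) (hc₃ : c₃ = c₁ + c₂)
    (H A c : ℝ → ℝ → ℝ)
    (hH : ∀ t₁ t₂, H t₁ t₂ = max (h₁ t₁ t₂ + h₃ t₁ t₂) (h₂ t₁ t₂ + h₄ t₁ t₂))
    (hA : ∀ t₁ t₂, A t₁ t₂ =
      c₃ * deltaIntegral₂ (nonnegPart T₁) (nonnegPart T₂) (fun s₁ s₂ => H s₁ s₂) t₁ t₂)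
    (hc : ∀ t₁ t₂, c t₁ t₂ = deltaIntegral (nonnegPart T₂) (fun s₂ => H t₁ s₂) 0 t₂) :
    ∀ t₁ ∈ nonnegPart T₁, ∀ t₂ ∈ nonnegPart T₂,
      u t₁ t₂ + v t₁ t₂ ≤
        c₃ + A t₁ t₂ * deltaExp (nonnegPart T₁) (fun s₁ => c s₁ t₂) t₁ 0 := by
  intro t₁ ht₁ t₂ ht₂
  have hS₁ := isClosed_nonnegPart hT₁
  have hS₂ := isClosed_nonnegPart hT₂
  have ha₁ := isLeast_nonnegPart h0₁
  have ha₂ := isLeast_nonnegPart h0₂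
  set S₁ := nonnegPart T₁
  set S₂ := nonnegPart T₂
  have mulc : ∀ {f g : ℝ → ℝ → ℝ}, ContinuousOn (Function.uncurry f) (S₁ ×ˢ S₂) →
      ContinuousOn (Function.uncurry g) (S₁ ×ˢ S₂) →
      ContinuousOn (Function.uncurry fun s r => f s r * g s r) (S₁ ×ˢ S₂) :=
    fun hf hg => hf.mul hg
  have addc : ∀ {f g : ℝ → ℝ → ℝ}, ContinuousOn (Function.uncurry f) (S₁ ×ˢ S₂) →
      ContinuousOn (Function.uncurry g) (S₁ ×ˢ S₂) →
      ContinuousOn (Function.uncurry fun s r => f s r + g s r) (S₁ ×ˢ S₂) :=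
    fun hf hg => hf.add hg
  have H_cont : ContinuousOn (Function.uncurry H) (S₁ ×ˢ S₂) :=
    ((addc h₁_cont h₃_cont).sup (addc h₂_cont h₄_cont)).congr fun x _ => hH x.1 x.2
  have H_nonneg : ∀ s ∈ S₁, ∀ r ∈ S₂, 0 ≤ H s r := fun s hs r hr => by
    rw [hH]
    exact (add_nonneg (h₁_nonneg s hs r hr) (h₃_nonneg s hs r hr)).trans (le_max_left _ _)
  have w_nonneg : ∀ s ∈ S₁, ∀ r ∈ S₂, 0 ≤ u s r + v s r := fun s hs r hr =>
    add_nonneg (u_nonneg s hs r hr) (v_nonneg s hs r hr)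
  have h₁u_cont := mulc h₁_cont u_cont
  have h₂v_cont := mulc h₂_cont v_cont
  have h₃u_cont := mulc h₃_cont u_cont
  have h₄v_cont := mulc h₄_cont v_cont
  have hw : ∀ s ∈ S₁, ∀ r ∈ S₂, u s r + v s r ≤
      c₃ + iteratedIntegral S₁ S₂ 0 0 (fun s r => H s r * (u s r + v s r)) s r := by
    intro s hs r hr
    have hus := hu s hs r hr
    have hvs := hv s hs r hr
    rw [deltaIntegral₂_eq hS₁ hS₂ ha₁ ha₂ h₁u_cont hs hr,
      deltaIntegral₂_eq hS₁ hS₂ ha₁ ha₂ h₂v_cont hs hr] at hus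
    rw [deltaIntegral₂_eq hS₁ hS₂ ha₁ ha₂ h₃u_cont hs hr,
      deltaIntegral₂_eq hS₁ hS₂ ha₁ ha₂ h₄v_cont hs hr] at hvs
    have hmono := iteratedIntegral_mono hS₁ hS₂ ha₁ ha₂
      (addc (addc h₁u_cont h₂v_cont) (addc h₃u_cont h₄v_cont)) (mulc H_cont (addc u_cont v_cont))
      (fun s hs r hr => by
        have e1 := mul_le_mul_of_nonneg_right
          (le_max_left (h₁ s r + h₃ s r) (h₂ s r + h₄ s r)) (u_nonneg s hs r hr)
        have e2 := mul_le_mul_of_nonneg_right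
          (le_max_right (h₁ s r + h₃ s r) (h₂ s r + h₄ s r)) (v_nonneg s hs r hr)
        rw [← hH] at e1 e2
        linarith) (ha₁.2 hs) (ha₂.2 hr)
    rw [iteratedIntegral_add hS₁ hS₂ ha₁ ha₂ (addc h₁u_cont h₂v_cont)
        (addc h₃u_cont h₄v_cont) (ha₂.2 hr),
      iteratedIntegral_add hS₁ hS₂ ha₁ ha₂ h₁u_cont h₂v_cont (ha₂.2 hr),
      iteratedIntegral_add hS₁ hS₂ ha₁ ha₂ h₃u_cont h₄v_cont (ha₂.2 hr)] at hmono
    linarith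
  rw [hA, deltaIntegral₂_eq hS₁ hS₂ ha₁ ha₂ H_cont ht₁ ht₂]
  refine le_add_mul_deltaExp (w := fun s r => u s r + v s r) hS₁ hS₂ ha₁ ha₂
    (hc₃ ▸ add_nonneg hc₁ hc₂) H_cont (addc u_cont v_cont) H_nonneg w_nonneg hw ht₁ ht₂
    fun s hs => ?_
  rw [hc]
  exact deltaIntegral_eq hS₂ ha₂ (continuousOn_slice H_cont hs) ht₂
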